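/- Let $\mathcal X \subseteq \mathbb R^d$ carry the Euclidean metric and its Borel $\sigma$-algebra, and let $\Psi$ be a nonempty set. For a symmetric positive semidefinite kernel $k:\mathcal X\times\mathcal X\to\mathbb R$ with reproducing kernel Hilbert space $\mathcal H_k$, and Borel probability measures $P,Q$ on $\mathcal X$, let $$\mathrm{MMD}_k(P,Q)=\sup_{f\in\mathcal H_k,\ \|f\|_{\mathcal H_k}\le 1}\ \Big(\mathbb E_{X\sim P}f(X)-\mathbb E_{Y\sim Q}f(Y)\Big)\in[0,\infty].$$ For a family $(k_\psi)_{\psi\in\Psi}$ of such kernels let $$D^\Psi_{\mathrm{MMD}}(P,Q)=\sup_{\psi\in\Psi}\mathrm{MMD}_{k_\psi}(P,Q),\qquad f_\psi^{P,Q}(x)=\frac{\mathbb E_{X\sim P}k_\psi(X,x)-\mathbb E_{Y\sim Q}k_\psi(Y,x)}{\mathrm{MMD}_{k_\psi}(P,Q)},$$ where the critic $f_\psi^{P,Q}$ is taken to be $0$ if $\mathrm{MMD}_{k_\psi}(P,Q)=0$. (a) Let $P_n$ ($n\in\mathbb N$) and $P$ be Borel probability measures on $\mathcal X$ such that, for every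 $\psi\in\Psi$, all functions in $\mathcal H_{k_\psi}$ are integrable with respect to $P$ and to every $P_n$ (so that the quantities above are well defined). Suppose the critics are uniformly bounded and have a common Lipschitz constant: $$\sup_{n,\,\psi\in\Psi,\,x\in\mathcal X}|f_\psi^{P_n,P}(x)|<\infty,\qquad \sup_{n,\,\psi\in\Psi}\|f_\psi^{P_n,P}\|_{\mathrm{Lip}}<\infty.$$ If $P_n\to P$ in distribution, then $D^\Psi_{\mathrm{MMD}}(P_n,P)\to0$. (b) Let $K$ be a symmetric positive semidefinite kernel on $\mathbb R^s$, let $\varphi_\psi:\mathcal X\to\mathbb R^s$ for $\psi\in\Psi$, and let $k_\psi(x,y)=K(\varphi_\psi(x),\varphi_\psi(y))$. Suppose $$\sup_{a\in\mathbb R^s}K(a,a)<\infty,\qquad \|K(a,\cdot)-K(b,\cdot)\|_{\mathcal H_K}\le L_K\|a-b\|\ \ (a,b\in\mathbb R^s),\qquad \sup_{\psi\in\Psi}\|\varphi_\psi\|_{\mathrm{Lip}}\le L_\varphi<\infty.$$ Then all functions in each $\mathcal H_{k_\psi}$ are integrable with respect to every Borel probability measure on $\mathcal X$, and the critics satisfy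 the condition of (a) uniformly over all pairs of Borel probability measures: $$\sup_{P,Q,\,\psi\in\Psi,\,x\in\mathcal X}|f_\psi^{P,Q}(x)|<\infty,\qquad \sup_{P,Q,\,\psi\in\Psi}\|f_\psi^{P,Q}\|_{\mathrm{Lip}}<\infty.$$ Consequently, $P_n\to P$ in distribution implies $D^\Psi_{\mathrm{MMD}}(P_n,P)\to0$. -/

import Mathlib

open MeasureTheory Filter Topology
open scoped NNReal

noncomputable section

/-- A real positive semidefinite kernel on `X`: a symmetric function `k : X → X → ℝ` all of whose
finite Gram matrices are positive semidefinite. -/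
structure PDKernel (X : Type*) where
  toFun : X → X → ℝ
  symm' : ∀ x y, toFun x y = toFun y x
  nonneg' : ∀ (s : Finset X) (c : X → ℝ), 0 ≤ ∑ x ∈ s, ∑ y ∈ s, c x * c y * toFun x y

namespace PDKernel

variable {X Y : Type*}

instance : CoeFun (PDKernel X) (fun _ => X → X → ℝ) := ⟨PDKernel.toFun⟩

/-- The kernel `K ∘ φ`, that is `(x, y) ↦ K (φ x) (φ y)`. -/
def comp (K : PDKernel Y) (φ : X → Y) : PDKernel X where
  toFun x y := K (φ x) (φ y)
  symm' x y := K.symm' _ _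
  nonneg' s c := by
    classical
    have hfib : ∀ g : X → ℝ, ∑ x ∈ s, g x
        = ∑ a ∈ s.image φ, ∑ x ∈ s with φ x = a, g x := fun g =>
      (Finset.sum_fiberwise_of_maps_to (fun x hx => Finset.mem_image_of_mem φ hx) g).symm
    have h := K.nonneg' (s.image φ) (fun a => ∑ x ∈ s with φ x = a, c x)
    refine h.trans_eq ?_
    rw [hfib]
    refine Finset.sum_congr rfl fun a _ => ?_
    have h2 : ∀ x ∈ s.filter (fun x => φ x = a), ∑ y ∈ s, c x * c y * K (φ x) (φ y)
        = ∑ b ∈ s.image φ, c x * (∑ y ∈ s with φ y = b, c y) * K a b := by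
      intro x hx
      rw [hfib]
      refine Finset.sum_congr rfl fun b _ => ?_
      rw [Finset.mul_sum, Finset.sum_mul]
      refine Finset.sum_congr rfl fun y hy => ?_
      rw [(Finset.mem_filter.1 hx).2, (Finset.mem_filter.1 hy).2]
    rw [Finset.sum_congr rfl h2, Finset.sum_comm]
    refine Finset.sum_congr rfl fun b _ => ?_
    rw [Finset.sum_mul, Finset.sum_mul]

/-- The kernel as an operator-valued matrix, the form in which Mathlib's construction of the
reproducing kernel Hilbert space of a kernel takes it. -/
def toMatrix (k : PDKernel X) : Matrix X X (ℝ →L[ℝ] ℝ) :=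
  Matrix.of fun x y => k x y • (1 : ℝ →L[ℝ] ℝ)

theorem posSemidef_toMatrix (k : PDKernel X) : k.toMatrix.PosSemidef := by
  have key := (RKHS.posSemidef_tfae (K := k.toMatrix)).out 0 2
  rw [key]
  refine ⟨?_, fun vv => ?_⟩
  · refine Matrix.IsHermitian.ext fun x y => ?_
    simp [toMatrix, k.symm' x y]
  · have h := k.nonneg' vv.support vv
    simp only [Finsupp.sum, toMatrix]
    refine h.trans_eq ?_
    simp only [RCLike.re_to_real]
    refine Finset.sum_congr rfl fun x _ => Finset.sum_congr rfl fun y _ => ?_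
    simp [k.symm' x y]
    ring

instance (k : PDKernel X) : Fact k.toMatrix.PosSemidef := ⟨k.posSemidef_toMatrix⟩

/-- The reproducing kernel Hilbert space `H_k` of the kernel `k`. Its elements coerce to functions
`X → ℝ`. -/
abbrev rkhs (k : PDKernel X) : Type _ := RKHS.OfKernel k.toMatrix

/-- The element `k(x, ·)` of `H_k`. -/
def feature (k : PDKernel X) (x : X) : k.rkhs := RKHS.kerFun k.rkhs x (1 : ℝ)

theorem feature_apply (k : PDKernel X) (x y : X) : k.feature x y = k x y := by
  rw [feature, RKHS.kerFun_apply, RKHS.OfKernel.kernel_ofKernel]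
  simp [toMatrix, k.symm' x y]

/-- The reproducing property. -/
theorem inner_feature (k : PDKernel X) (f : k.rkhs) (x : X) : inner ℝ f (k.feature x) = f x := by
  rw [feature, RKHS.inner_kerFun]
  simp

end PDKernel

section MMD

variable {X : Type*} [MeasurableSpace X]

/-- All functions in `H_k` are `P`-integrable, so that `E_P f` makes sense for each of them. -/
def RKHSIntegrable (k : PDKernel X) (P : ProbabilityMeasure X) : Prop :=
  ∀ f : k.rkhs, Integrable (fun x => f x) (P : Measure X)

/-- The maximum mean discrepancy: the supremum, in the extended reals, of `E_P f - E_Q f` over the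
unit ball of `H_k`. -/
def mmd (k : PDKernel X) (P Q : ProbabilityMeasure X) : EReal :=
  ⨆ f : {f : k.rkhs // ‖f‖ ≤ 1},
    (((∫ x, f.1 x ∂(P : Measure X)) - ∫ x, f.1 x ∂(Q : Measure X) : ℝ) : EReal)

/-- The optimized MMD of a family of kernels. -/
def optMMD {Ψ : Type*} (k : Ψ → PDKernel X) (P Q : ProbabilityMeasure X) : EReal :=
  ⨆ ψ : Ψ, mmd (k ψ) P Q

/-- The normalized MMD critic. It is the zero function when the MMD vanishes. -/
def critic (k : PDKernel X) (P Q : ProbabilityMeasure X) (x : X) : ℝ :=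
  ((∫ y, k y x ∂(P : Measure X)) - ∫ y, k y x ∂(Q : Measure X)) / (mmd k P Q).toReal

end MMD

end

/-! Integration against `P` is bounded on `H_k` by the closed graph theorem, so it has a Riesz
representer. The MMD is therefore the norm of the difference of two representers, attained at the
normalized difference, which is the critic. Thus each MMD is a gap between integrals of one bounded
Lipschitz function; a Lévy-Prokhorov estimate bounds it using only `B` and `L`, hence uniformly in
`ψ`. For (b), Cauchy-Schwarz with the reproducing property transfers boundedness and the Lipschitz
constant from the feature map to the unit ball of `H_k`, where the critics lie. -/

/-- If all functions of `H_k` are `P`-integrable, then integration against `P` is a bounded linear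
functional on `H_k`, represented by the mean embedding of `P`. -/
theorem RKHSIntegrable.exists_meanEmbedding {X : Type*} [MeasurableSpace X] {k : PDKernel X}
    {P : ProbabilityMeasure X} (h : RKHSIntegrable k P) :
    ∃ m : k.rkhs, ∀ f : k.rkhs, inner ℝ m f = ∫ x, f x ∂(P : Measure X) := by
  let T : k.rkhs →ₗ[ℝ] Lp ℝ 1 (P : Measure X) :=
    { toFun := fun f => (h f).toL1 _
      map_add' := fun f g => by
        rw [← Integrable.toL1_add]
        congr 1
        exact RKHS.coe_add f g
      map_smul' := fun c f => by
        rw [RingHom.id_apply, ← Integrable.toL1_smul]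
        congr 1
        exact RKHS.coe_smul f c }
  -- Closed graph: an `L¹` limit is an a.e. limit along a subsequence, and `H_k` limits are
  -- pointwise, so the two agree.
  have hT : Continuous T := by
    refine T.continuous_of_seq_closed_graph fun u f g hu hg => ?_
    obtain ⟨ns, hns, hae⟩ := (tendstoInMeasure_of_tendsto_Lp hg).exists_seq_tendsto_ae
    have hcoe : ∀ᵐ x ∂(P : Measure X), ∀ n, (T (u n) : X → ℝ) x = u n x :=
      ae_all_iff.2 fun n => (h (u n)).coeFn_toL1
    refine Lp.ext ?_
    filter_upwards [hae, hcoe, (h f).coeFn_toL1] with x hx hc hf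
    have h1 : Tendsto (fun i => u (ns i) x) atTop (𝓝 (f x)) :=
      ((RKHS.continuous_eval x).tendsto f).comp (hu.comp hns.tendsto_atTop)
    have h2 : Tendsto (fun i => u (ns i) x) atTop (𝓝 (g x)) := by
      refine hx.congr fun i => ?_
      exact hc (ns i)
    exact (tendsto_nhds_unique h2 h1).trans hf.symm
  let I : StrongDual ℝ k.rkhs := (L1.integralCLM (μ := (P : Measure X)) (E := ℝ)).comp ⟨T, hT⟩
  refine ⟨(InnerProductSpace.toDual ℝ k.rkhs).symm I, fun f => ?_⟩
  rw [InnerProductSpace.toDual_symm_apply]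
  exact (L1.integral_eq (T f)).symm.trans <|
    (L1.integral_eq_integral _).trans (L1.integral_of_fun_eq_integral (h f))

/-- The supremum of a linear functional over the unit ball of a Hilbert space is attained at the
normalized representing vector. -/
theorem iSup_inner_unitBall {H : Type*} [NormedAddCommGroup H] [InnerProductSpace ℝ H] (v : H) :
    ⨆ f : {f : H // ‖f‖ ≤ 1}, ((inner ℝ v f.1 : ℝ) : EReal) = (‖v‖ : ℝ) := by
  refine le_antisymm (iSup_le fun f => EReal.coe_le_coe_iff.2 ?_) ?_
  · exact (real_inner_le_norm v f.1).trans (mul_le_of_le_one_right (norm_nonneg v) f.2)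
  -- For `v = 0` the witness is `0` since `0⁻¹ = 0`, so no case split is needed.
  · have hn : ‖‖v‖⁻¹ • v‖ ≤ 1 := by
      rw [norm_smul, norm_inv, norm_norm]
      exact inv_mul_le_one
    refine le_iSup_of_le ⟨‖v‖⁻¹ • v, hn⟩ (EReal.coe_le_coe_iff.2 ?_)
    rw [inner_smul_right, real_inner_self_eq_norm_mul_norm, ← mul_assoc]
    exact (inv_mul_mul_self _).ge

/-- The critic is an element of the unit ball of `H_k` that attains the supremum in the maximum mean
discrepancy. -/
theorem exists_rkhs_eq_critic {X : Type*} [MeasurableSpace X] {k : PDKernel X}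
    {P Q : ProbabilityMeasure X} (hP : RKHSIntegrable k P) (hQ : RKHSIntegrable k Q) :
    ∃ g : k.rkhs, ‖g‖ ≤ 1 ∧ (∀ x, critic k P Q x = g x) ∧
      mmd k P Q = ((∫ x, g x ∂(P : Measure X)) - ∫ x, g x ∂(Q : Measure X) : ℝ) := by
  obtain ⟨p, hp⟩ := hP.exists_meanEmbedding
  obtain ⟨q, hq⟩ := hQ.exists_meanEmbedding
  have hmmd : mmd k P Q = (‖p - q‖ : ℝ) := by
    rw [← iSup_inner_unitBall, mmd]
    simp only [inner_sub_left, hp, hq]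
  refine ⟨‖p - q‖⁻¹ • (p - q), ?_, fun x => ?_, ?_⟩
  · rw [norm_smul, norm_inv, norm_norm]
    exact inv_mul_le_one
  · have hx : ∀ y, k y x = k.feature x y := fun y => by rw [k.feature_apply, k.symm']
    simp only [critic, hmmd, EReal.toReal_coe, hx]
    rw [← hp, ← hq, ← inner_sub_left, PDKernel.inner_feature, RKHS.coe_smul, Pi.smul_apply,
      smul_eq_mul, div_eq_inv_mul]
  · rw [hmmd, ← hp, ← hq, ← inner_sub_left, inner_smul_right, real_inner_self_eq_norm_mul_norm,
      ← mul_assoc, inv_mul_mul_self]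

/-- Integrals of a bounded Lipschitz function against two probability measures are close when the
measures are close in the Lévy-Prokhorov distance. -/
theorem integral_sub_integral_le_of_levyProkhorovEDist_lt {X : Type*} [PseudoMetricSpace X]
    [MeasurableSpace X] [OpensMeasurableSpace X] {P Q : Measure X} [IsProbabilityMeasure P]
    [IsProbabilityMeasure Q] {ε : ℝ} (hε : 0 < ε)
    (hPQ : levyProkhorovEDist P Q < ENNReal.ofReal ε) {f : X → ℝ} {B : ℝ} {L : ℝ≥0}
    (hB : ∀ x, |f x| ≤ B) (hL : LipschitzWith L f) :
    (∫ x, f x ∂P) - ∫ x, f x ∂Q ≤ (L + 2 * B) * ε := by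
  have hX : Nonempty X := nonempty_of_isProbabilityMeasure P
  have hB0 : 0 ≤ B := (abs_nonneg _).trans (hB hX.some)
  have hbd : ∀ x, ‖f x + B‖ ≤ 2 * B := fun x => by
    rw [Real.norm_eq_abs, abs_le]
    constructor <;> linarith [abs_le.1 (hB x)]
  have hnn : ∀ x, 0 ≤ f x + B := fun x => by linarith [(abs_le.1 (hB x)).1]
  -- Layer-cake formulas need a nonnegative function; the shift by `B` cancels in the difference of
  -- integrals.
  let F : BoundedContinuousFunction X ℝ := BoundedContinuousFunction.ofNormedAddCommGroup
    (fun x => f x + B) (hL.continuous.add continuous_const) (2 * B) hbd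
  have hF : ∀ x, F x = f x + B := fun _ => rfl
  have hFn : ‖F‖ ≤ 2 * B :=
    BoundedContinuousFunction.norm_ofNormedAddCommGroup_le _ (by positivity) hbd
  have hf : ∀ (ν : Measure X) [IsProbabilityMeasure ν], Integrable f ν := fun ν _ =>
    .of_bound hL.continuous.measurable.aestronglyMeasurable B
      (.of_forall fun x => (Real.norm_eq_abs _).trans_le (hB x))
  have h1 := BoundedContinuousFunction.integral_le_of_levyProkhorovEDist_lt P Q hε hPQ F
    (.of_forall hnn)
  have hanti : ∀ A : ℝ → Set X, Antitone A → ∀ s : Set ℝ, volume s ≠ ⊤ →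
      IntegrableOn (fun t => Q.real (A t)) s := fun A hA s hs => by
    refine Measure.integrableOn_of_bounded (M := 1) hs ?_ (.of_forall fun t => ?_)
    · exact (Antitone.measurable fun _ _ hst => measureReal_mono (hA hst)).aestronglyMeasurable
    · rw [Real.norm_eq_abs, abs_of_nonneg measureReal_nonneg]
      exact measureReal_le_one
  have hεL : 0 ≤ (L : ℝ) * ε := by positivity
  have hlevel : ∀ s : Set ℝ, volume s ≠ ⊤ →
      IntegrableOn (fun t => Q.real {x | t ≤ F x + L * ε}) s :=
    hanti (fun t => {x | t ≤ F x + L * ε}) fun _ _ hst _ hx => hst.trans hx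
  have hthick : ∀ s : Set ℝ, volume s ≠ ⊤ →
      IntegrableOn (fun t => Q.real (Metric.thickening ε {x | t ≤ F x})) s :=
    hanti (fun t => Metric.thickening ε {x | t ≤ F x}) fun _ _ hst =>
      Metric.thickening_subset_of_subset ε fun _ hx => hst.trans hx
  -- Moving by less than `ε` changes `F` by at most `L * ε`, so thickening a superlevel set amounts
  -- to raising `F`.
  have hsub : ∀ t : ℝ, Metric.thickening ε {x | t ≤ F x} ⊆ {x | t ≤ F x + L * ε} := by
    intro t x hx
    obtain ⟨y, hy, hxy⟩ := Metric.mem_thickening_iff.1 hx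
    have hd := hL.dist_le_mul y x
    rw [Real.dist_eq, dist_comm] at hd
    have hmul : (L : ℝ) * dist x y ≤ L * ε := by gcongr
    simp only [Set.mem_ofPred_eq, hF] at hy ⊢
    linarith [le_abs_self (f y - f x)]
  have h2 : ∫ t in Set.Ioc 0 ‖F‖, Q.real (Metric.thickening ε {x | t ≤ F x})
      ≤ ∫ t in Set.Ioc 0 (2 * B + L * ε), Q.real {x | t ≤ F x + L * ε} := by
    calc _ ≤ ∫ t in Set.Ioc 0 ‖F‖, Q.real {x | t ≤ F x + L * ε} :=
          setIntegral_mono (hthick _ measure_Ioc_lt_top.ne) (hlevel _ measure_Ioc_lt_top.ne)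
            fun t => measureReal_mono (hsub t)
      _ ≤ _ := setIntegral_mono_set (hlevel _ measure_Ioc_lt_top.ne)
          (.of_forall fun _ => measureReal_nonneg)
          (Set.Ioc_subset_Ioc_right (by linarith)).eventuallyLE
  have h3 : ∫ x, (F x + L * ε) ∂Q
      = ∫ t in Set.Ioc 0 (2 * B + L * ε), Q.real {x | t ≤ F x + L * ε} := by
    refine Integrable.integral_eq_integral_Ioc_meas_le
      ((F.integrable Q).add (integrable_const _)) (.of_forall fun x => ?_) (.of_forall fun x => ?_)
    · exact add_nonneg (hnn x) hεL
    · exact add_le_add_left ((le_abs_self _).trans (hbd x)) _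
  have hint : ∀ (ν : Measure X) [IsProbabilityMeasure ν], ∫ x, F x ∂ν = (∫ x, f x ∂ν) + B :=
    fun ν _ => by
      simp only [hF]
      rw [integral_add (hf ν) (integrable_const _)]
      simp
  rw [integral_add (F.integrable Q) (integrable_const _), hint Q] at h3
  rw [hint P] at h1
  simp only [integral_const, probReal_univ, smul_eq_mul, one_mul] at h3
  have h4 : ε * ‖F‖ ≤ ε * (2 * B) := by gcongr
  linarith

/-- Convergence in distribution makes the optimized MMD vanish in the limit if the critics are
uniformly bounded with a common Lipschitz constant. -/
theorem tendsto_optMMD_of_critic_bounded_lipschitz {X : Type*} [PseudoMetricSpace X]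
    [TopologicalSpace.SeparableSpace X] [MeasurableSpace X] [BorelSpace X] {Ψ : Type*} [Nonempty Ψ]
    {k : Ψ → PDKernel X} {Pn : ℕ → ProbabilityMeasure X} {P : ProbabilityMeasure X}
    (hP : ∀ ψ, RKHSIntegrable (k ψ) P) (hPn : ∀ ψ n, RKHSIntegrable (k ψ) (Pn n)) {B : ℝ}
    {L : ℝ≥0} (hB : ∀ n ψ x, |critic (k ψ) (Pn n) P x| ≤ B)
    (hL : ∀ n ψ, LipschitzWith L (critic (k ψ) (Pn n) P)) (hlim : Tendsto Pn atTop (𝓝 P)) :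
    Tendsto (fun n => optMMD k (Pn n) P) atTop (𝓝 0) := by
  have hX : Nonempty X := nonempty_of_isProbabilityMeasure (P : Measure X)
  let ψ₀ : Ψ := Classical.arbitrary Ψ
  have hB0 : 0 ≤ B := (abs_nonneg _).trans (hB 0 ψ₀ hX.some)
  have hdist := tendsto_iff_dist_tendsto_zero.1
    ((LevyProkhorov.continuous_ofMeasure_probabilityMeasure (Ω := X)).tendsto P |>.comp hlim)
  set δ : ℕ → ℝ := fun n => dist (LevyProkhorov.ofMeasure (Pn n)) (LevyProkhorov.ofMeasure P)
  -- The term `1 / (n + 1)` supplies the strict inequality and positive radius required even when `δ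
  -- n = 0`.
  have hup : ∀ n, optMMD k (Pn n) P ≤ (((L + 2 * B) * (δ n + 1 / (n + 1 : ℝ)) : ℝ) : EReal) := by
    refine fun n => iSup_le fun ψ => ?_
    obtain ⟨g, -, hg, hm⟩ := exists_rkhs_eq_critic (hPn ψ n) (hP ψ)
    have hpos : 0 < 1 / (n + 1 : ℝ) := by positivity
    rw [hm, EReal.coe_le_coe_iff]
    simp only [← hg]
    refine integral_sub_integral_le_of_levyProkhorovEDist_lt
      (add_pos_of_nonneg_of_pos dist_nonneg hpos) ?_ (hB n ψ) (hL n ψ)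
    have he : levyProkhorovEDist (Pn n : Measure X) (P : Measure X) = ENNReal.ofReal (δ n) := by
      rw [← edist_dist]
      rfl
    rw [he, ENNReal.ofReal_lt_ofReal_iff (add_pos_of_nonneg_of_pos dist_nonneg hpos)]
    exact lt_add_of_pos_right _ hpos
  -- The zero function gives the bound; an empty `Ψ` would give `⊥`.
  have hlow : ∀ n, 0 ≤ optMMD k (Pn n) P := fun n => by
    refine le_iSup_of_le ψ₀ (le_iSup_of_le ⟨0, by simp⟩ ?_)
    simp
  refine tendsto_of_tendsto_of_tendsto_of_le_of_le tendsto_const_nhds ?_ hlow hup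
  rw [← EReal.coe_zero, EReal.tendsto_coe]
  simpa using (hdist.add tendsto_one_div_add_atTop_nhds_zero_nat).const_mul ((L : ℝ) + 2 * B)

namespace PDKernel

variable {X Y : Type*}

theorem inner_feature_feature (k : PDKernel X) (x y : X) :
    inner ℝ (k.feature x) (k.feature y) = k x y := by
  rw [inner_feature, feature_apply]

theorem norm_feature_sq (k : PDKernel X) (x : X) : ‖k.feature x‖ ^ 2 = k x x := by
  rw [← inner_feature_feature, real_inner_self_eq_norm_sq]

theorem norm_feature_sub_sq (k : PDKernel X) (x y : X) :
    ‖k.feature x - k.feature y‖ ^ 2 = k x x - 2 * k x y + k y y := by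
  rw [norm_sub_sq_real, norm_feature_sq, norm_feature_sq, inner_feature_feature]

/-- The two norms live in different Hilbert spaces, but both are determined by the same kernel
values. -/
theorem norm_feature_comp_sub (K : PDKernel Y) (φ : X → Y) (x y : X) :
    ‖(K.comp φ).feature x - (K.comp φ).feature y‖ = ‖K.feature (φ x) - K.feature (φ y)‖ := by
  rw [← sq_eq_sq₀ (norm_nonneg _) (norm_nonneg _), norm_feature_sub_sq, norm_feature_sub_sq]
  rfl

theorem abs_apply_le (k : PDKernel X) {C : ℝ} (hC : ∀ x, k x x ≤ C) (f : k.rkhs) (x : X) :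
    |f x| ≤ ‖f‖ * √C := by
  rw [← inner_feature]
  refine (abs_real_inner_le_norm _ _).trans ?_
  gcongr
  exact Real.le_sqrt_of_sq_le ((norm_feature_sq k x).trans_le (hC x))

theorem lipschitzWith_rkhs [PseudoMetricSpace X] (k : PDKernel X) {M : ℝ≥0}
    (hM : LipschitzWith M k.feature) (f : k.rkhs) : LipschitzWith (‖f‖₊ * M) f := by
  refine LipschitzWith.of_dist_le_mul fun x y => ?_
  have h := hM.dist_le_mul x y
  rw [Real.dist_eq, ← inner_feature, ← inner_feature, ← inner_sub_right]
  refine (abs_real_inner_le_norm _ _).trans ?_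
  rw [NNReal.coe_mul, coe_nnnorm, mul_assoc, ← dist_eq_norm]
  gcongr

theorem lipschitzWith_feature_comp [PseudoMetricSpace X] [SeminormedAddCommGroup Y]
    {K : PDKernel Y} {φ : X → Y} {c : ℝ} {M : ℝ≥0}
    (hK : ∀ a b, ‖K.feature a - K.feature b‖ ≤ c * ‖a - b‖) (hφ : LipschitzWith M φ) :
    LipschitzWith (c.toNNReal * M) (K.comp φ).feature := by
  refine LipschitzWith.of_dist_le_mul fun x y => ?_
  have h := hφ.dist_le_mul x y
  rw [dist_eq_norm, norm_feature_comp_sub]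
  refine (hK _ _).trans ?_
  rw [NNReal.coe_mul, mul_assoc, ← dist_eq_norm]
  gcongr
  exact Real.le_coe_toNNReal c

end PDKernel

/-- Every function in the reproducing kernel Hilbert space of a bounded kernel with Lipschitz
feature map is integrable with respect to every probability measure. -/
theorem RKHSIntegrable.of_bounded_of_lipschitzWith {X : Type*} [PseudoMetricSpace X]
    [MeasurableSpace X] [OpensMeasurableSpace X] {k : PDKernel X} {C : ℝ} {M : ℝ≥0}
    (hC : ∀ x, k x x ≤ C) (hM : LipschitzWith M k.feature) (P : ProbabilityMeasure X) :
    RKHSIntegrable k P := fun f =>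
  .of_bound (k.lipschitzWith_rkhs hM f).continuous.measurable.aestronglyMeasurable (‖f‖ * √C)
    (.of_forall fun x => (Real.norm_eq_abs _).trans_le (k.abs_apply_le hC f x))

/-- The critic has norm at most one in `H_k`, so the bound does not depend on `P` or `Q`. -/
theorem abs_critic_le {X : Type*} [MeasurableSpace X] {k : PDKernel X} {C : ℝ}
    (hC : ∀ x, k x x ≤ C) {P Q : ProbabilityMeasure X} (hP : RKHSIntegrable k P)
    (hQ : RKHSIntegrable k Q) (x : X) : |critic k P Q x| ≤ √C := by
  obtain ⟨g, hg, hcrit, -⟩ := exists_rkhs_eq_critic hP hQ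
  rw [hcrit]
  exact (k.abs_apply_le hC g x).trans (mul_le_of_le_one_left (Real.sqrt_nonneg C) hg)

theorem lipschitzWith_critic {X : Type*} [PseudoMetricSpace X] [MeasurableSpace X] {k : PDKernel X}
    {M : ℝ≥0} (hM : LipschitzWith M k.feature) {P Q : ProbabilityMeasure X}
    (hP : RKHSIntegrable k P) (hQ : RKHSIntegrable k Q) : LipschitzWith M (critic k P Q) := by
  obtain ⟨g, hg, hcrit, -⟩ := exists_rkhs_eq_critic hP hQ
  rw [funext hcrit]
  exact (k.lipschitzWith_rkhs hM g).weaken (mul_le_of_le_one_left zero_le hg)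

theorem mainTheorem5 {d : ℕ} (X : Set (EuclideanSpace ℝ (Fin d))) {Ψ : Type*} [Nonempty Ψ] :
    -- critics uniformly bounded and uniformly Lipschitz along the sequence
    (∀ (k : Ψ → PDKernel X) (Pn : ℕ → ProbabilityMeasure X) (P : ProbabilityMeasure X),
      (∀ ψ, RKHSIntegrable (k ψ) P) → (∀ ψ n, RKHSIntegrable (k ψ) (Pn n)) →
      (∃ B : ℝ, ∀ n ψ x, |critic (k ψ) (Pn n) P x| ≤ B) →
      (∃ L : ℝ≥0, ∀ n ψ, LipschitzWith L (critic (k ψ) (Pn n) P)) →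
      Tendsto Pn atTop (𝓝 P) →
      Tendsto (fun n => optMMD k (Pn n) P) atTop (𝓝 0)) ∧
    -- the kernels `K ∘ φ ψ`
    (∀ (s : ℕ) (K : PDKernel (EuclideanSpace ℝ (Fin s)))
      (φ : Ψ → X → EuclideanSpace ℝ (Fin s)) (LK : ℝ) (Lφ : ℝ≥0),
      BddAbove (Set.range fun a => K a a) →
      (∀ a b, ‖K.feature a - K.feature b‖ ≤ LK * ‖a - b‖) →
      (∀ ψ, LipschitzWith Lφ (φ ψ)) →
      (∀ (P : ProbabilityMeasure X) ψ, RKHSIntegrable (K.comp (φ ψ)) P) ∧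
      (∃ B : ℝ, ∀ (P Q : ProbabilityMeasure X) ψ x, |critic (K.comp (φ ψ)) P Q x| ≤ B) ∧
      (∃ L : ℝ≥0, ∀ (P Q : ProbabilityMeasure X) ψ,
        LipschitzWith L (critic (K.comp (φ ψ)) P Q)) ∧
      ∀ (Pn : ℕ → ProbabilityMeasure X) (P : ProbabilityMeasure X),
        Tendsto Pn atTop (𝓝 P) →
        Tendsto (fun n => optMMD (fun ψ => K.comp (φ ψ)) (Pn n) P) atTop (𝓝 0)) := by

  refine ⟨fun k Pn P hP hPn ⟨B, hB⟩ ⟨L, hL⟩ hlim =>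
    tendsto_optMMD_of_critic_bounded_lipschitz hP hPn hB hL hlim, ?_⟩
  rintro s K φ LK Lφ ⟨C, hC⟩ hK hφ
  have hbound : ∀ ψ x, K.comp (φ ψ) x x ≤ C := fun ψ x => hC ⟨φ ψ x, rfl⟩
  have hlip : ∀ ψ, LipschitzWith (LK.toNNReal * Lφ) (K.comp (φ ψ)).feature := fun ψ =>
    PDKernel.lipschitzWith_feature_comp hK (hφ ψ)
  have hint : ∀ (P : ProbabilityMeasure X) ψ, RKHSIntegrable (K.comp (φ ψ)) P := fun P ψ =>
    .of_bounded_of_lipschitzWith (hbound ψ) (hlip ψ) P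
  refine ⟨hint, ⟨√C, fun P Q ψ => abs_critic_le (hbound ψ) (hint P ψ) (hint Q ψ)⟩,
    ⟨LK.toNNReal * Lφ, fun P Q ψ => lipschitzWith_critic (hlip ψ) (hint P ψ) (hint Q ψ)⟩,
    fun Pn P hlim => ?_⟩
  exact tendsto_optMMD_of_critic_bounded_lipschitz (hint P) (fun ψ n => hint (Pn n) ψ)
    (fun n ψ => abs_critic_le (hbound ψ) (hint (Pn n) ψ) (hint P ψ))
    (fun n ψ => lipschitzWith_critic (hlip ψ) (hint (Pn n) ψ) (hint P ψ)) hlim
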